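/- Let $p\in\mathbb N$. For each $n$ consider the linear model $y=X\beta+\varepsilon$, where $\beta\in\mathbb R^p$ is unknown, $\varepsilon=(\varepsilon_1,\dots,\varepsilon_n)'$ with $\varepsilon_1,\varepsilon_2,\dots$ i.i.d. (not necessarily Gaussian) with mean $0$ and finite variance $\sigma^2>0$, and $X=(x_1',\dots,x_n')'$ is a non-random $n\times p$ matrix that changes with $n$ only by appending rows. Assume $C_n=X'X/n\to C$ as $n\to\infty$ with $C$ positive definite (so $X$ has full column rank for all large $n$). Let $\lambda_{n,j}\ge 0$ be non-random tuning parameters with $n^{-1/2}\lambda_{n,j}\to\lambda_j\in[0,\infty)$ for $j=1,\dots,p$, and put $\Lambda=\operatorname{diag}(\lambda_1,\dots,\lambda_p)$. Let $\hat\beta_L$ be the Lasso estimator, i.e. the minimizer over $b\in\mathbb R^p$ of $\|y-Xb\|^2+2\sum_{j=1}^p\lambda_{n,j}|b_j|$ (unique when $X$ has full column rank). For $d\in\{-1,1\}^p$ and $m\in\mathbb R^p$ let $$A_C^d(m)=\bigcap_{j=1}^p\{z\in\mathbb R^p:\ d_j(Cm)_j\le d_j(Cz)_j,\ d_jz_j\le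 0\},$$ and say that $M\subseteq\mathbb R^p$ satisfies Condition A with $C$ if $A_C^d(m)\subseteq M$ for all $d\in\{-1,1\}^p$ and all $m\in M$. Let $W\sim N(0,\sigma^2C)$ and, for $d\in\{-1,1\}^p$, let $\hat u^d$ be the unique minimizer of $Q^d(u)=u'Cu-2W'u+2\sum_{j=1}^p\lambda_jd_ju_j$ over $u\in\mathbb R^p$. Then $\hat u^d\sim N(-C^{-1}\Lambda d,\ \sigma^2C^{-1})$ for every $d\in\{-1,1\}^p$. Moreover, if $M\subseteq\mathbb R^p$ satisfies Condition A with $C$ and $\min_{d\in\{-1,1\}^p}P(\hat u^d\in M)=1-\alpha$, then $$\liminf_{n\to\infty}\ \inf_{\beta\in\mathbb R^p}P_\beta\big(\beta\in\hat\beta_L-n^{-1/2}M\big)=1-\alpha,$$ where $\hat\beta_L-n^{-1/2}M=\{\hat\beta_L-n^{-1/2}m:\ m\in M\}$. -/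

import Mathlib

open MeasureTheory ProbabilityTheory Filter Topology Matrix

/-- A minimizer of `f` (an arbitrary point if `f` has no minimizer). It is used only for strictly
convex coercive functions, which have exactly one minimizer. -/
noncomputable def argminOf {E : Type*} [Nonempty E] (f : E → ℝ) : E :=
  Classical.epsilon fun u => ∀ v, f u ≤ f v

/-- The set `{-1, 1}^p`. -/
def signVectors (p : ℕ) : Set (Fin p → ℝ) := {d | ∀ j, d j = -1 ∨ d j = 1}

/-- The `n × p` regressor matrix consisting of the first `n` of the given rows. -/
def designMatrix {p : ℕ} (x : ℕ → Fin p → ℝ) (n : ℕ) : Matrix (Fin n) (Fin p) ℝ :=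
  Matrix.of fun i j => x i j

/-- `C_n = X'X / n`. -/
noncomputable def gramMatrix {p : ℕ} (x : ℕ → Fin p → ℝ) (n : ℕ) : Matrix (Fin p) (Fin p) ℝ :=
  (n : ℝ)⁻¹ • ((designMatrix x n)ᵀ * designMatrix x n)

/-- The objective `‖y - X b‖² + 2 ∑_j lam_j |b_j|`. -/
noncomputable def lassoObjective {n p : ℕ} (X : Matrix (Fin n) (Fin p) ℝ) (y : Fin n → ℝ)
    (lam : Fin p → ℝ) (b : EuclideanSpace ℝ (Fin p)) : ℝ :=
  ‖WithLp.toLp 2 (y - X *ᵥ b.ofLp)‖ ^ 2 + 2 * ∑ j, lam j * |b j|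

/-- The componentwise tuned Lasso estimator. -/
noncomputable def lassoEstimator {n p : ℕ} (X : Matrix (Fin n) (Fin p) ℝ) (lam : Fin p → ℝ)
    (y : Fin n → ℝ) : EuclideanSpace ℝ (Fin p) :=
  argminOf (lassoObjective X y lam)

/-- The data vector `y = X β + ε` of the linear model with `n` observations. -/
def response {Ω : Type*} {p : ℕ} (x : ℕ → Fin p → ℝ) (ε : ℕ → Ω → ℝ) (n : ℕ)
    (β : EuclideanSpace ℝ (Fin p)) (ω : Ω) : Fin n → ℝ :=
  fun i => (designMatrix x n *ᵥ β.ofLp) i + ε i ω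

/-- The set `b - n^{-1/2} M = {b - n^{-1/2} m : m ∈ M}`. -/
noncomputable def confidenceSet {p : ℕ} (n : ℕ) (M : Set (EuclideanSpace ℝ (Fin p)))
    (b : EuclideanSpace ℝ (Fin p)) : Set (EuclideanSpace ℝ (Fin p)) :=
  (fun m => b - (√(n : ℝ))⁻¹ • m) '' M

/-- The set `A_C^d(m)`, an intersection of `2p` half-spaces. -/
def shapeSet {p : ℕ} (C : Matrix (Fin p) (Fin p) ℝ) (d : Fin p → ℝ)
    (m : EuclideanSpace ℝ (Fin p)) : Set (EuclideanSpace ℝ (Fin p)) :=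
  ⋂ j, {z | d j * (C *ᵥ m.ofLp) j ≤ d j * (C *ᵥ z.ofLp) j ∧ d j * z j ≤ 0}

/-- Condition A with matrix `C`. -/
def ConditionA {p : ℕ} (C : Matrix (Fin p) (Fin p) ℝ) (M : Set (EuclideanSpace ℝ (Fin p))) :
    Prop :=
  ∀ d ∈ signVectors p, ∀ m ∈ M, shapeSet C d m ⊆ M

/-- The function `Q^d(u) = u'Cu - 2 w'u + 2 ∑_j lam_j d_j u_j`, at a realization `w` of `W`. -/
noncomputable def limitObjective {p : ℕ} (C : Matrix (Fin p) (Fin p) ℝ) (lam d : Fin p → ℝ)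
    (w u : EuclideanSpace ℝ (Fin p)) : ℝ :=
  u.ofLp ⬝ᵥ C *ᵥ u.ofLp - 2 * (w.ofLp ⬝ᵥ u.ofLp) + 2 * ∑ j, lam j * d j * u j

/-- The minimizer `û^d` of `Q^d`, as a function of the realization `w` of `W`. -/
noncomputable def limitMinimizer {p : ℕ} (C : Matrix (Fin p) (Fin p) ℝ) (lam d : Fin p → ℝ)
    (w : EuclideanSpace ℝ (Fin p)) : EuclideanSpace ℝ (Fin p) :=
  argminOf (limitObjective C lam d w)

/-! Write `G` for the Gram matrix, `u = √n (β̂ - β)`, `t = √n β`. Coverage means `u ∈ M`, and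
stationarity reads `G u = w - g` with `g` the scaled subgradient. For a sign vector `d` the orthant
solution `v = G⁻¹ (w - L d)` is affine in the errors, so it obeys a central limit theorem whose
limit is the law of `û^d`.

Lower bound (`IsLassoSolution.mem_of_conditionA`): choose `d` with `d_j β_j ≥ 0`. Then `G u = G v +
(L d - g)`. Where `g_j ≠ L_j d_j`, the increment points in direction `d_j` and `d_j u_j ≤ 0`;
elsewhere the increment vanishes and the sign may be chosen freely. This is the relation in
Condition A, except for `G` in place of `C`. Replacing `v` by a point at distance tending to zero,
uniformly in `β` and the errors, repairs this. So coverage holds whenever `v` lies slightly inside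
`M`, and only finitely many `d` occur.

Upper bound (`iInf_coverage_le`): for fixed `n` and `β = K d`, the Lasso solution equals `v` with
probability tending to one as `K → ∞`, so the infimum is at most `P(v ∈ M)`.

Weak convergence matches the two bounds because `M` has a null boundary
(`ConditionA.volume_frontier`): inside an open orthant, Condition A makes `M` the preimage of an
upper set under a linear isomorphism. The liminf is therefore a limit. -/

/-- `u` satisfies the first order conditions of the Lasso with Gram matrix `G`, score `w`, tuning
parameters `L` and centre `t`; the vector `g` plays the role of `L` times a subgradient of the
absolute values at `u + t`. -/
structure IsLassoSolution {p : ℕ} (G : Matrix (Fin p) (Fin p) ℝ) (w L t u g : Fin p → ℝ) :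
    Prop where
  score : G *ᵥ u = w - g
  bound : ∀ j, |g j| ≤ L j
  of_pos : ∀ j, 0 < u j + t j → g j = L j
  of_neg : ∀ j, u j + t j < 0 → g j = - L j

/-! ### Stationarity conditions and existence of the Lasso estimator -/

/-- Take `s` with the sign of `g`, divide by `|s|` and let `s → 0`: the quadratic term disappears.
-/
theorem abs_le_of_forall_quadratic {a g l : ℝ}
    (h : ∀ s : ℝ, 0 ≤ a * s ^ 2 - 2 * s * g + 2 * l * |s|) :
    |g| ≤ l := by
  by_contra! hlt
  have key : ∀ s : ℝ, 0 < s → 2 * (|g| - l) ≤ a * s := by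
    intro s hs
    have h1 : 2 * s * (|g| - l) ≤ a * s ^ 2 := by
      rcases abs_cases g with ⟨hg, -⟩ | ⟨hg, -⟩
      · have := h s
        rw [abs_of_pos hs] at this
        rw [hg]; nlinarith
      · have := h (-s)
        rw [abs_neg, abs_of_pos hs] at this
        rw [hg]; nlinarith
    nlinarith
  -- A step so short that `a * s ≤ |g| - l`, against the bound `2 * (|g| - l) ≤ a * s`.
  have := key ((|g| - l) / (|a| + 1)) (div_pos (by linarith) (by positivity))
  have h2 : a * ((|g| - l) / (|a| + 1)) ≤ |g| - l := by
    rw [← mul_div_assoc, div_le_iff₀ (by positivity)]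
    nlinarith [le_abs_self a]
  linarith

theorem eq_zero_of_forall_quadratic {a c r : ℝ} (hr : 0 < r)
    (h : ∀ s : ℝ, |s| < r → 0 ≤ a * s ^ 2 + 2 * s * c) : c = 0 := by
  by_contra hc
  have hpos : 0 < |c| := abs_pos.mpr hc
  have key : ∀ s : ℝ, 0 < s → s < r → 2 * |c| ≤ a * s := by
    intro s hs hsr
    have h1 : 2 * s * |c| ≤ a * s ^ 2 := by
      rcases abs_cases c with ⟨hg, -⟩ | ⟨hg, -⟩
      · have := h (-s) (by rwa [abs_neg, abs_of_pos hs])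
        rw [hg]; nlinarith
      · have := h s (by rwa [abs_of_pos hs])
        rw [hg]; nlinarith
    nlinarith
  have hs0 : 0 < min (r / 2) (|c| / (|a| + 1)) :=
    lt_min (by linarith) (div_pos hpos (by positivity))
  have := key _ hs0 ((min_le_left _ _).trans_lt (by linarith))
  have h2 : a * min (r / 2) (|c| / (|a| + 1)) ≤ |c| := by
    calc a * min (r / 2) (|c| / (|a| + 1)) ≤ |a| * (|c| / (|a| + 1)) :=
          mul_le_mul (le_abs_self a) (min_le_right _ _) hs0.le (abs_nonneg a)
      _ ≤ |c| := by
          rw [← mul_div_assoc, div_le_iff₀ (by positivity)]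
          nlinarith [abs_nonneg a]
  linarith

theorem lassoObjective_eq {n p : ℕ} (X : Matrix (Fin n) (Fin p) ℝ) (y : Fin n → ℝ)
    (lam : Fin p → ℝ) (b : EuclideanSpace ℝ (Fin p)) :
    lassoObjective X y lam b =
      (y - X *ᵥ b.ofLp) ⬝ᵥ (y - X *ᵥ b.ofLp) + 2 * ∑ j, lam j * |b j| := by
  rw [lassoObjective, EuclideanSpace.real_norm_sq_eq]
  simp only [dotProduct, sq]

theorem lassoObjective_add_single {n p : ℕ} (X : Matrix (Fin n) (Fin p) ℝ) (y : Fin n → ℝ)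
    (lam : Fin p → ℝ) (b : EuclideanSpace ℝ (Fin p)) (j : Fin p) (s : ℝ) :
    lassoObjective X y lam (b + EuclideanSpace.single j s) = lassoObjective X y lam b +
      ((X.col j ⬝ᵥ X.col j) * s ^ 2 - 2 * s * (Xᵀ *ᵥ (y - X *ᵥ b.ofLp)) j +
        2 * lam j * (|b j + s| - |b j|)) := by
  have h1 : X *ᵥ (b + EuclideanSpace.single j s).ofLp = X *ᵥ b.ofLp + s • X.col j := by
    have : (b + EuclideanSpace.single j s).ofLp = b.ofLp + Pi.single j s := by
      ext k; simp [Pi.single_apply]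
    rw [this, mulVec_add, mulVec_single]
    simp
  have h2 : ∑ k, lam k * |(b + EuclideanSpace.single j s) k| =
      ∑ k, lam k * |b k| + lam j * (|b j + s| - |b j|) := by
    rw [← sub_eq_iff_eq_add', ← Finset.sum_sub_distrib, Finset.sum_eq_single j]
    · simp; ring
    · intro k _ hk
      simp [hk]
    · simp
  have h3 : (Xᵀ *ᵥ (y - X *ᵥ b.ofLp)) j = X.col j ⬝ᵥ (y - X *ᵥ b.ofLp) := rfl
  rw [lassoObjective_eq, lassoObjective_eq, h1, h2, h3, ← sub_sub]
  set r := y - X *ᵥ b.ofLp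
  simp only [sub_dotProduct, dotProduct_sub, smul_dotProduct, dotProduct_smul, smul_eq_mul]
  rw [dotProduct_comm r (X.col j)]
  ring

/-- Perturbing one coordinate changes the smooth part by an exact quadratic. At a nonzero
coordinate, steps shorter than `|b j|` keep its sign, so the penalty is linear there. -/
theorem lassoObjective_minimizer_kkt {n p : ℕ} {X : Matrix (Fin n) (Fin p) ℝ} {y : Fin n → ℝ}
    {lam : Fin p → ℝ} {b : EuclideanSpace ℝ (Fin p)}
    (hlam : ∀ j, 0 ≤ lam j)
    (hb : ∀ b', lassoObjective X y lam b ≤ lassoObjective X y lam b') (j : Fin p) :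
    |(Xᵀ *ᵥ (y - X *ᵥ b.ofLp)) j| ≤ lam j ∧
      (0 < b j → (Xᵀ *ᵥ (y - X *ᵥ b.ofLp)) j = lam j) ∧
      (b j < 0 → (Xᵀ *ᵥ (y - X *ᵥ b.ofLp)) j = - lam j) := by
  have h : ∀ s : ℝ, 0 ≤ (X.col j ⬝ᵥ X.col j) * s ^ 2 -
      2 * s * (Xᵀ *ᵥ (y - X *ᵥ b.ofLp)) j + 2 * lam j * (|b j + s| - |b j|) := fun s => by
    have := hb (b + EuclideanSpace.single j s)
    rw [lassoObjective_add_single] at this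
    linarith
  refine ⟨abs_le_of_forall_quadratic (a := X.col j ⬝ᵥ X.col j) fun s => ?_, fun hj => ?_,
    fun hj => ?_⟩
  · have h1 := h s
    have h2 : |b j + s| - |b j| ≤ |s| := by linarith [abs_add_le (b j) s]
    nlinarith [mul_le_mul_of_nonneg_left h2 (hlam j)]
  · have := eq_zero_of_forall_quadratic (a := X.col j ⬝ᵥ X.col j)
      (c := lam j - (Xᵀ *ᵥ (y - X *ᵥ b.ofLp)) j) hj fun s hs => by
        have h1 := h s
        rw [abs_of_pos hj, abs_of_pos (by linarith [neg_abs_le s])] at h1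
        linarith
    linarith
  · have := eq_zero_of_forall_quadratic (a := X.col j ⬝ᵥ X.col j) (r := - b j)
      (c := - lam j - (Xᵀ *ᵥ (y - X *ᵥ b.ofLp)) j) (by linarith) fun s hs => by
        have h1 := h s
        rw [abs_of_neg hj, abs_of_neg (by linarith [le_abs_self s])] at h1
        linarith
    linarith

theorem exists_lassoObjective_minimizer {n p : ℕ} {X : Matrix (Fin n) (Fin p) ℝ}
    (hX : Function.Injective (X *ᵥ ·)) (y : Fin n → ℝ) {lam : Fin p → ℝ}
    (hlam : ∀ j, 0 ≤ lam j) :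
    ∃ b, ∀ b', lassoObjective X y lam b ≤ lassoObjective X y lam b' := by
  have hcont : Continuous (lassoObjective X y lam) := by
    unfold lassoObjective
    have : Continuous fun b : EuclideanSpace ℝ (Fin p) => X *ᵥ b.ofLp :=
      Continuous.matrix_mulVec continuous_const (PiLp.continuous_ofLp _ _)
    fun_prop
  refine hcont.exists_forall_le ?_
  let f : EuclideanSpace ℝ (Fin p) →ₗ[ℝ] EuclideanSpace ℝ (Fin n) :=
    (WithLp.linearEquiv 2 ℝ (Fin n → ℝ)).symm.toLinearMap ∘ₗ X.mulVecLin ∘ₗ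
      (WithLp.linearEquiv 2 ℝ (Fin p → ℝ)).toLinearMap
  have hf : ∀ b, f b = WithLp.toLp 2 (X *ᵥ b.ofLp) := fun b => rfl
  have hinj : Function.Injective f := fun a b hab => by
    rw [hf, hf] at hab
    exact WithLp.ofLp_injective 2 (hX (WithLp.toLp_injective 2 hab))
  -- Coercivity: an injective linear map in finite dimension is a closed embedding, and the penalty
  -- only adds to the residual norm.
  have hemb : IsClosedEmbedding f :=
    LinearMap.isClosedEmbedding_of_injective (LinearMap.ker_eq_bot.mpr hinj)
  have h1 : Tendsto (fun b => WithLp.toLp 2 y - f b) (cocompact _) (cocompact _) :=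
    (Homeomorph.subLeft (WithLp.toLp 2 y)).isClosedEmbedding.tendsto_cocompact.comp
      hemb.tendsto_cocompact
  have h2 : Tendsto (fun b => ‖WithLp.toLp 2 y - f b‖ ^ 2) (cocompact _) atTop :=
    (tendsto_pow_atTop two_ne_zero).comp (tendsto_norm_cocompact_atTop.comp h1)
  refine tendsto_atTop_mono (fun b => ?_) h2
  have h3 : 0 ≤ ∑ j, lam j * |b j| :=
    Finset.sum_nonneg fun j _ => mul_nonneg (hlam j) (abs_nonneg _)
  simp only [lassoObjective, hf, WithLp.toLp_sub]
  linarith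

theorem argminOf_spec {E : Type*} [Nonempty E] {f : E → ℝ} (h : ∃ u, ∀ v, f u ≤ f v) (v : E) :
    f (argminOf f) ≤ f v :=
  Classical.epsilon_spec h v

/-! ### Orthant solutions and their relation to the Lasso -/

/-- The solution of `G u = w - L d`: the minimizer of the quadratic function that replaces
`|u_j + t_j|` by `d_j (u_j + t_j)`. -/
noncomputable def orthantSolution {p : ℕ} (G : Matrix (Fin p) (Fin p) ℝ) (L d w : Fin p → ℝ) :
    Fin p → ℝ :=
  G⁻¹ *ᵥ (w - L * d)

theorem mulVec_orthantSolution {p : ℕ} {G : Matrix (Fin p) (Fin p) ℝ} (hG : IsUnit G.det)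
    (L d w : Fin p → ℝ) : G *ᵥ orthantSolution G L d w = w - L * d := by
  rw [orthantSolution, mulVec_mulVec, mul_nonsing_inv _ hG, one_mulVec]

namespace IsLassoSolution

variable {p : ℕ} {C G : Matrix (Fin p) (Fin p) ℝ} {w L t u g d : Fin p → ℝ}

theorem sub_orthantSolution (h : IsLassoSolution G w L t u g) (hG : IsUnit G.det)
    (d : Fin p → ℝ) : u - orthantSolution G L d w = G⁻¹ *ᵥ (L * d - g) := by
  have hu : u = G⁻¹ *ᵥ (w - g) := by
    rw [← h.score, mulVec_mulVec, nonsing_inv_mul _ hG, one_mulVec]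
  rw [hu, orthantSolution, ← mulVec_sub]
  congr 1
  abel

/-- On the event that the orthant solution lies well inside a set satisfying Condition A, so does
the Lasso solution. -/
theorem mem_of_conditionA (h : IsLassoSolution G w L t u g) (hG : IsUnit G.det)
    (hC : IsUnit C.det) {M : Set (EuclideanSpace ℝ (Fin p))} (hM : ConditionA C M)
    (hd : d ∈ signVectors p) (hdt : ∀ j, 0 ≤ d j * t j)
    (hmem : WithLp.toLp 2 (orthantSolution G L d w +
      (C⁻¹ * (C - G) * G⁻¹) *ᵥ (L * d - g)) ∈ M) :
    WithLp.toLp 2 u ∈ M := by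
  set m : Fin p → ℝ := orthantSolution G L d w + (C⁻¹ * (C - G) * G⁻¹) *ᵥ (L * d - g) with hm
  -- `m` is the orthant solution `v` shifted by `C⁻¹ (C - G) (u - v)`, exactly what turns `G u = G v
  -- + (L d - g)` into the same identity for `C`.
  have hCu : C *ᵥ u = C *ᵥ m + (L * d - g) := by
    have h1 : C *ᵥ ((C⁻¹ * (C - G) * G⁻¹) *ᵥ (L * d - g)) =
        (C - G) *ᵥ (u - orthantSolution G L d w) := by
      rw [h.sub_orthantSolution hG d, mulVec_mulVec, mulVec_mulVec, mul_assoc,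
        mul_nonsing_inv_cancel_left _ _ hC]
    rw [hm, mulVec_add, h1, mulVec_sub, sub_mulVec, sub_mulVec, mulVec_orthantSolution hG,
      h.score]
    abel
  classical
  -- Where `g j = L j * d j` the first half-space condition is an equality for either sign, so the
  -- sign is chosen to satisfy `d' j * u j ≤ 0`.
  let d' : Fin p → ℝ := fun j => if g j = L j * d j then (if 0 ≤ u j then -1 else 1) else d j
  have hd' : d' ∈ signVectors p := fun j => by
    by_cases h1 : g j = L j * d j
    · by_cases h2 : 0 ≤ u j <;> simp [d', h1, h2]
    · simpa [d', h1] using hd j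
  refine hM d' hd' _ hmem (Set.mem_iInter.mpr fun j => ?_)
  simp only [Set.mem_ofPred_eq, hCu, Pi.add_apply, Pi.sub_apply, Pi.mul_apply]
  by_cases h1 : g j = L j * d j
  · refine ⟨by rw [h1, sub_self, add_zero], ?_⟩
    by_cases h2 : 0 ≤ u j
    · simp [d', h1, h2]
    · simpa [d', h1, h2] using (not_le.mp h2).le
  · have hdj : d' j = d j := by simp [d', h1]
    rw [hdj]
    have habs := abs_le.mp (h.bound j)
    have ht := hdt j
    rcases hd j with hj | hj <;> rw [hj] at ht h1 ⊢
    · refine ⟨by linarith, ?_⟩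
      have : ¬ (u j + t j < 0) := fun h2 => h1 (by rw [h.of_neg j h2]; ring)
      linarith
    · refine ⟨by linarith, ?_⟩
      have : ¬ (0 < u j + t j) := fun h2 => h1 (by rw [h.of_pos j h2]; ring)
      linarith

/-- If the orthant solution lies in its orthant, then it is the Lasso solution. -/
theorem eq_orthantSolution (h : IsLassoSolution G w L t u g) (hG : G.PosDef)
    (hd : d ∈ signVectors p) (hdt : ∀ j, 0 < d j * (orthantSolution G L d w j + t j)) :
    u = orthantSolution G L d w := by
  have hdet : IsUnit G.det := (isUnit_iff_isUnit_det G).mp hG.isUnit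
  set v := orthantSolution G L d w with hv
  by_contra hne
  have hpos := hG.dotProduct_mulVec_pos (sub_ne_zero.mpr hne)
  have hG' : G *ᵥ (u - v) = L * d - g := by
    rw [mulVec_sub, h.score, hv, mulVec_orthantSolution hdet]
    abel
  rw [hG', star_trivial] at hpos
  -- Each summand is nonpositive: either `u j + t j` lies strictly on side `d j` and `g j = L j * d
  -- j`, or it does not, while `v j + t j` does.
  refine absurd hpos (not_lt.mpr (Finset.sum_nonpos fun j _ => ?_))
  have habs := abs_le.mp (h.bound j)
  have hj' := hdt j
  simp only [Pi.sub_apply, Pi.mul_apply]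
  rcases hd j with hj | hj <;> rw [hj] at hj' ⊢
  · rcases lt_or_ge (u j + t j) 0 with h1 | h1
    · rw [h.of_neg j h1]; simp
    · exact mul_nonpos_of_nonneg_of_nonpos (by linarith) (by linarith)
  · rcases lt_or_ge 0 (u j + t j) with h1 | h1
    · rw [h.of_pos j h1]; simp
    · exact mul_nonpos_of_nonpos_of_nonneg (by linarith) (by linarith)

end IsLassoSolution

/-! ### Rescaling the model; the limiting minimizer -/

/-- The normalized score `X'ε / √n`. -/
noncomputable def score {p : ℕ} (x : ℕ → Fin p → ℝ) (n : ℕ) (e : Fin n → ℝ) : Fin p → ℝ :=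
  (√(n : ℝ))⁻¹ • ((designMatrix x n)ᵀ *ᵥ e)

theorem injective_mulVec_designMatrix {p : ℕ} {x : ℕ → Fin p → ℝ} {n : ℕ}
    (hG : IsUnit (gramMatrix x n).det) : Function.Injective (designMatrix x n *ᵥ ·) := by
  intro a b hab
  have h : gramMatrix x n *ᵥ a = gramMatrix x n *ᵥ b := by
    simp only [gramMatrix, smul_mulVec, ← mulVec_mulVec]
    rw [show designMatrix x n *ᵥ a = designMatrix x n *ᵥ b from hab]
  have := congrArg ((gramMatrix x n)⁻¹ *ᵥ ·) h
  simpa only [mulVec_mulVec, nonsing_inv_mul _ hG, one_mulVec] using this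

/-- Since `u + t = √n β̂`, the subgradient conditions only involve the signs of `β̂`, and `g` is
`X'(y - X β̂) / √n`. -/
theorem exists_isLassoSolution {Ω : Type*} {p : ℕ} {x : ℕ → Fin p → ℝ} {n : ℕ} (hn : 0 < n)
    (hG : IsUnit (gramMatrix x n).det) {lam : Fin p → ℝ} (hlam : ∀ j, 0 ≤ lam j)
    (ε : ℕ → Ω → ℝ) (β : EuclideanSpace ℝ (Fin p)) (ω : Ω) :
    ∃ g, IsLassoSolution (gramMatrix x n) (score x n fun i => ε i ω) (fun j => lam j / √(n : ℝ))
      (√(n : ℝ) • β).ofLp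
      (√(n : ℝ) • (lassoEstimator (designMatrix x n) lam (response x ε n β ω) - β)).ofLp g := by
  have hs : 0 < √(n : ℝ) := Real.sqrt_pos.mpr (by exact_mod_cast hn)
  set X := designMatrix x n with hX
  set y := response x ε n β ω with hy
  set b := lassoEstimator X lam y with hb
  have hmin : ∀ b', lassoObjective X y lam b ≤ lassoObjective X y lam b' :=
    argminOf_spec (exists_lassoObjective_minimizer (injective_mulVec_designMatrix hG) y hlam)
  have hkkt := lassoObjective_minimizer_kkt hlam hmin
  refine ⟨(√(n : ℝ))⁻¹ • (Xᵀ *ᵥ (y - X *ᵥ b.ofLp)), ?_, fun j => ?_, fun j hj => ?_,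
    fun j hj => ?_⟩
  · have hy' : y = X *ᵥ β.ofLp + fun i : Fin n => ε i ω := rfl
    have hr : y - X *ᵥ b.ofLp = (fun i : Fin n => ε i ω) - X *ᵥ (b - β).ofLp := by
      rw [hy', WithLp.ofLp_sub, mulVec_sub]
      abel
    have hn' : (n : ℝ)⁻¹ * √(n : ℝ) = (√(n : ℝ))⁻¹ := by
      have := Real.mul_self_sqrt (Nat.cast_nonneg (α := ℝ) n)
      field_simp
      linarith
    rw [hr, score, ← hX, ← smul_sub, ← mulVec_sub, sub_sub_cancel, gramMatrix, ← hX,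
      WithLp.ofLp_smul, mulVec_smul, smul_mulVec, smul_smul, mul_comm, hn', mulVec_mulVec]
  · have := (hkkt j).1
    simp only [Pi.smul_apply, smul_eq_mul, abs_mul, abs_of_pos (inv_pos.mpr hs), div_eq_inv_mul]
    gcongr
  · have h1 : 0 < √(n : ℝ) * b j := by simpa [mul_sub] using hj
    simp only [Pi.smul_apply, smul_eq_mul, div_eq_inv_mul]
    rw [(hkkt j).2.1 (pos_of_mul_pos_right h1 hs.le)]
  · have h1 : √(n : ℝ) * b j < 0 := by simpa [mul_sub] using hj
    simp only [Pi.smul_apply, smul_eq_mul, div_eq_inv_mul]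
    rw [(hkkt j).2.2 (by by_contra! h2; linarith [mul_nonneg hs.le h2]), mul_neg]

theorem mem_confidenceSet_iff {p n : ℕ} (hn : 0 < n) {M : Set (EuclideanSpace ℝ (Fin p))}
    {b β : EuclideanSpace ℝ (Fin p)} :
    β ∈ confidenceSet n M b ↔ √(n : ℝ) • (b - β) ∈ M := by
  have hs : √(n : ℝ) ≠ 0 := (Real.sqrt_pos.mpr (by exact_mod_cast hn)).ne'
  constructor
  · rintro ⟨m, hm, rfl⟩
    simpa [smul_smul, hs] using hm
  · intro h
    exact ⟨_, h, by simp [smul_smul, hs]⟩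

/-- Completing the square around `v` leaves a positive definite form, which vanishes only at `v`. -/
theorem limitMinimizer_eq {p : ℕ} {C : Matrix (Fin p) (Fin p) ℝ} (hC : C.PosDef)
    (lam d : Fin p → ℝ) (w : EuclideanSpace ℝ (Fin p)) :
    limitMinimizer C lam d w = WithLp.toLp 2 (orthantSolution C lam d w.ofLp) := by
  have hdet : IsUnit C.det := (isUnit_iff_isUnit_det C).mp hC.isUnit
  set v := orthantSolution C lam d w.ofLp with hv
  have hCv : C *ᵥ v = w.ofLp - lam * d := mulVec_orthantSolution hdet lam d w.ofLp
  have hsymm : ∀ a b : Fin p → ℝ, a ⬝ᵥ C *ᵥ b = b ⬝ᵥ C *ᵥ a := fun a b => by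
    have hT : Cᵀ = C := hC.isHermitian
    rw [dotProduct_mulVec, ← mulVec_transpose, hT, dotProduct_comm]
  have hQ : ∀ u, limitObjective C lam d w u =
      (u.ofLp - v) ⬝ᵥ C *ᵥ (u.ofLp - v) - v ⬝ᵥ C *ᵥ v := fun u => by
    have h1 : ∑ j, lam j * d j * u j = (lam * d) ⬝ᵥ u.ofLp := rfl
    have h2 : w.ofLp ⬝ᵥ u.ofLp = (C *ᵥ v) ⬝ᵥ u.ofLp + (lam * d) ⬝ᵥ u.ofLp := by
      rw [hCv, sub_dotProduct]; ring
    rw [limitObjective, h1, h2, mulVec_sub, sub_dotProduct, dotProduct_sub, dotProduct_sub,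
      hsymm v u.ofLp, dotProduct_comm (C *ᵥ v)]
    ring
  have hnn : ∀ a : Fin p → ℝ, 0 ≤ a ⬝ᵥ C *ᵥ a := fun a => by
    simpa using hC.posSemidef.dotProduct_mulVec_nonneg a
  have hspec := argminOf_spec (f := limitObjective C lam d w)
    ⟨WithLp.toLp 2 v, fun u => by
      rw [hQ, hQ]
      simpa using hnn (u.ofLp - v)⟩ (WithLp.toLp 2 v)
  change limitObjective C lam d w (limitMinimizer C lam d w) ≤ _ at hspec
  rw [hQ, hQ] at hspec
  by_contra hne
  have hne' : (limitMinimizer C lam d w).ofLp - v ≠ 0 := fun h => hne (by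
    rw [← sub_eq_zero.mp h])
  have := hC.dotProduct_mulVec_pos hne'
  rw [star_trivial] at this
  rw [show (WithLp.toLp 2 v).ofLp - v = 0 from sub_self v, zero_dotProduct] at hspec
  linarith

/-! ### Absolute continuity of Gaussian laws and the boundary of `M` -/

theorem absolutelyContinuous_pi_fin {n : ℕ} {μ ν : Fin n → Measure ℝ} [∀ i, SigmaFinite (μ i)]
    [∀ i, SigmaFinite (ν i)] (h : ∀ i, μ i ≪ ν i) : Measure.pi μ ≪ Measure.pi ν := by
  induction n with
  | zero => rw [Measure.pi_of_empty μ, Measure.pi_of_empty ν]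
  | succ n ih =>
    have hμ := measurePreserving_piFinSuccAbove μ 0
    have hν := measurePreserving_piFinSuccAbove ν 0
    rw [← (hμ.symm _).map_eq, ← (hν.symm _).map_eq]
    exact ((h 0).prod (ih fun j => h _)).map (MeasurableEquiv.measurable _)

theorem stdGaussian_absolutelyContinuous (p : ℕ) :
    stdGaussian (EuclideanSpace ℝ (Fin p)) ≪ volume := by
  rw [← map_pi_eq_stdGaussian, ← (PiLp.volume_preserving_toLp (Fin p)).map_eq]
  exact (absolutelyContinuous_pi_fin fun _ =>
    gaussianReal_absolutelyContinuous 0 one_ne_zero).map (by fun_prop)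

-- The law is the image of the standard Gaussian under an affine map with linear part `√S`,
-- invertible because `S` is positive definite.
open scoped MatrixOrder in
theorem multivariateGaussian_absolutelyContinuous {p : ℕ} (μ : EuclideanSpace ℝ (Fin p))
    {S : Matrix (Fin p) (Fin p) ℝ} (hS : S.PosDef) : multivariateGaussian μ S ≪ volume := by
  have hunit : IsUnit (CFC.sqrt S) := (CFC.isUnit_sqrt_iff S hS.posSemidef.nonneg).mpr hS.isUnit
  set A := toEuclideanCLM (n := Fin p) (𝕜 := ℝ) (CFC.sqrt S) with hA
  have hdet : LinearMap.det (A : EuclideanSpace ℝ (Fin p) →ₗ[ℝ] EuclideanSpace ℝ (Fin p)) ≠ 0 := by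
    have h1 : IsUnit A := hunit.map toEuclideanCLM
    have h2 := (h1.map ContinuousLinearMap.toLinearMapRingHom).map
      (LinearMap.det (M := EuclideanSpace ℝ (Fin p)) (A := ℝ))
    exact h2.ne_zero
  refine ((stdGaussian_absolutelyContinuous p).map (f := fun x => μ + A x) (by fun_prop)).trans
    (Measure.AbsolutelyContinuous.mk fun s hs h0 => ?_)
  rw [Measure.map_apply (by fun_prop) hs]
  have h1 : volume ((fun x : EuclideanSpace ℝ (Fin p) => μ + x) ⁻¹' s) = 0 := by
    rwa [measure_preimage_add]
  have h2 := Measure.addHaar_preimage_linearMap volume hdet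
    ((fun x : EuclideanSpace ℝ (Fin p) => μ + x) ⁻¹' s)
  rwa [h1, mul_zero] at h2

/-- Within an open orthant, Condition A says that `M` is an upper set for a partial order. -/
theorem ConditionA.mem_of_le {p : ℕ} {C : Matrix (Fin p) (Fin p) ℝ}
    {M : Set (EuclideanSpace ℝ (Fin p))} (hM : ConditionA C M) {d : Fin p → ℝ}
    (hd : d ∈ signVectors p) {m z : EuclideanSpace ℝ (Fin p)} (hm : m ∈ M)
    (hle : d * (C *ᵥ m.ofLp) ≤ d * (C *ᵥ z.ofLp)) (hz : ∀ j, d j * z j < 0) : z ∈ M :=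
  hM d hd m hm (Set.mem_iInter.mpr fun j => ⟨hle j, (hz j).le⟩)

theorem volume_preimage_signed_mulVec {p : ℕ} {C : Matrix (Fin p) (Fin p) ℝ} (hC : IsUnit C.det)
    {d : Fin p → ℝ} (hd : d ∈ signVectors p) {N : Set (Fin p → ℝ)} (hN : volume N = 0) :
    volume {z : EuclideanSpace ℝ (Fin p) | d * (C *ᵥ z.ofLp) ∈ N} = 0 := by
  have hdet : LinearMap.det (toLin' (diagonal d * C)) ≠ 0 := by
    rw [LinearMap.det_toLin', det_mul, det_diagonal]
    refine mul_ne_zero (Finset.prod_ne_zero_iff.mpr fun j _ => ?_) hC.ne_zero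
    rcases hd j with h | h <;> simp [h]
  have h1 := Measure.addHaar_preimage_linearMap volume hdet N
  rw [hN, mul_zero] at h1
  have h2 := (PiLp.volume_preserving_ofLp (Fin p)).quasiMeasurePreserving.preimage_null h1
  convert h2 using 2
  ext z
  simp only [Set.mem_ofPred_eq, Set.mem_preimage, toLin'_apply, ← mulVec_mulVec]
  have : d * (C *ᵥ z.ofLp) = diagonal d *ᵥ (C *ᵥ z.ofLp) := by
    ext j; simp [mulVec_diagonal]
  rw [this]

theorem volume_coord_eq_zero {p : ℕ} (j : Fin p) :
    volume {z : EuclideanSpace ℝ (Fin p) | z j = 0} = 0 := by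
  let f : EuclideanSpace ℝ (Fin p) →ₗ[ℝ] ℝ := (EuclideanSpace.proj j).toLinearMap
  have h := Measure.addHaar_submodule volume (LinearMap.ker f) fun htop => by
    have h1 : EuclideanSpace.single j (1 : ℝ) ∈ LinearMap.ker f := htop ▸ Submodule.mem_top
    simp [f] at h1
  convert h using 2
  ext z
  simp [f, LinearMap.mem_ker]

theorem finite_signVectors (p : ℕ) : (signVectors p).Finite :=
  Set.Finite.subset (Set.Finite.pi' fun _ : Fin p => Set.toFinite {(-1 : ℝ), 1}) fun _ hd j => hd j

/-- Off the null coordinate hyperplanes the problem is local to open orthants, where `M` is the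
preimage of an upper set; upper sets have null frontier. -/
theorem ConditionA.volume_frontier {p : ℕ} {C : Matrix (Fin p) (Fin p) ℝ} (hC : IsUnit C.det)
    {M : Set (EuclideanSpace ℝ (Fin p))} (hM : ConditionA C M) : volume (frontier M) = 0 := by
  classical
  let S : (Fin p → ℝ) → Set (Fin p → ℝ) := fun d =>
    {y | ∃ m ∈ M, (∀ j, d j * m j < 0) ∧ d * (C *ᵥ m.ofLp) ≤ y}
  let T : (Fin p → ℝ) → EuclideanSpace ℝ (Fin p) → (Fin p → ℝ) := fun d z => d * (C *ᵥ z.ofLp)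
  have hT : ∀ d, Continuous (T d) := fun d =>
    continuous_const.mul (Continuous.matrix_mulVec continuous_const (PiLp.continuous_ofLp _ _))
  have hsub : frontier M ⊆ (⋃ j, {z : EuclideanSpace ℝ (Fin p) | z j = 0}) ∪
      ⋃ d ∈ signVectors p, {z | d * (C *ᵥ z.ofLp) ∈ frontier (S d)} := by
    intro z hz
    by_cases h0 : ∃ j, z j = 0
    · exact Or.inl (Set.mem_iUnion.mpr h0)
    push Not at h0
    right
    -- The signs are opposite to those of `z`, since Condition A asks for `d j * z j ≤ 0`.
    let d : Fin p → ℝ := fun j => if 0 < z j then -1 else 1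
    have hd : d ∈ signVectors p := fun j => by
      by_cases h : 0 < z j <;> simp [d, h]
    have hdz : ∀ j, d j * z j < 0 := fun j => by
      by_cases h : 0 < z j
      · simp [d, h]
      · simpa [d, h] using lt_of_le_of_ne (not_lt.mp h) (h0 j)
    refine Set.mem_iUnion₂.mpr ⟨d, hd, ?_⟩
    let O : Set (EuclideanSpace ℝ (Fin p)) := {z | ∀ j, d j * z j < 0}
    have hO : IsOpen O := by
      simp only [O, Set.ofPred_forall]
      exact isOpen_iInter_of_finite fun j => isOpen_lt (by fun_prop) continuous_const
    have hOM : M ∩ O = T d ⁻¹' S d ∩ O := by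
      ext y
      constructor
      · rintro ⟨hy, hyO⟩
        exact ⟨⟨y, hy, hyO, le_rfl⟩, hyO⟩
      · rintro ⟨⟨m, hm, -, hle⟩, hyO⟩
        exact ⟨hM.mem_of_le hd hm hle hyO, hyO⟩
    have h1 : z ∈ frontier (T d ⁻¹' S d) ∩ O := by
      have h2 : frontier (M ∩ O) ∩ O = frontier M ∩ O := frontier_inter_open_inter hO
      have h3 : frontier (T d ⁻¹' S d ∩ O) ∩ O = frontier (T d ⁻¹' S d) ∩ O :=
        frontier_inter_open_inter hO
      rw [← h3, ← hOM, h2]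
      exact ⟨hz, hdz⟩
    exact (hT d).frontier_preimage_subset _ h1.1
  refine measure_mono_null hsub (measure_union_null (measure_iUnion_null volume_coord_eq_zero)
    ((measure_biUnion_null_iff (finite_signVectors p).countable).mpr fun d hd =>
      volume_preimage_signed_mulVec hC hd (IsUpperSet.null_frontier ?_)))
  rintro a b hab ⟨m, hm, hmd, hle⟩
  exact ⟨m, hm, hmd, hle.trans hab⟩

/-! ### Central limit theorem for weighted sums -/

theorem norm_prod_sub_prod_le_sum {ι : Type*} (s : Finset ι) {a b : ι → ℂ} (ha : ∀ i, ‖a i‖ ≤ 1)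
    (hb : ∀ i, ‖b i‖ ≤ 1) : ‖∏ i ∈ s, a i - ∏ i ∈ s, b i‖ ≤ ∑ i ∈ s, ‖a i - b i‖ := by
  classical
  induction s using Finset.induction_on with
  | empty => simp
  | insert i s hi ih =>
    rw [Finset.prod_insert hi, Finset.prod_insert hi, Finset.sum_insert hi]
    have h1 : a i * ∏ j ∈ s, a j - b i * ∏ j ∈ s, b j =
        (a i - b i) * ∏ j ∈ s, a j + b i * (∏ j ∈ s, a j - ∏ j ∈ s, b j) := by ring
    have h2 : ‖∏ j ∈ s, a j‖ ≤ 1 := by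
      rw [norm_prod]
      exact Finset.prod_le_one (fun _ _ => norm_nonneg _) fun j _ => ha j
    rw [h1]
    refine (norm_add_le _ _).trans (add_le_add ?_ ?_)
    · rw [norm_mul]
      exact mul_le_of_le_one_right (norm_nonneg _) h2
    · rw [norm_mul]
      exact (mul_le_of_le_one_left (norm_nonneg _) (hb i)).trans ih

section WeightedSums

variable {Ω : Type*} [MeasurableSpace Ω] {P : Measure Ω} [IsProbabilityMeasure P]

/-- After scaling to unit variance, the second-order Taylor expansion agrees with that of the
standard Gaussian characteristic function. -/
theorem charFun_sub_exp_isLittleO {X : Ω → ℝ} {σ : ℝ} (hσ : 0 < σ) (hX : AEMeasurable X P)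
    (h0 : ∫ ω, X ω ∂P = 0) (h2 : variance X P = σ ^ 2) :
    (fun t : ℝ => charFun (P.map X) t - Complex.exp (-((σ * t) ^ 2 / 2 : ℝ)))
      =o[𝓝 0] fun t => t ^ 2 := by
  have h1 := taylor_charFun_two (X := fun ω => σ⁻¹ * X ω) (P := P) (by fun_prop)
    (by rw [integral_const_mul, h0, mul_zero])
    (by
      have hv := variance_of_integral_eq_zero hX h0
      simp only [Pi.pow_apply, mul_pow, integral_const_mul]
      rw [← hv, h2]
      field_simp)
  have hg := taylor_charFun_two (X := id) (P := gaussianReal 0 1) (by fun_prop) (by simp)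
    (by
      have hv := variance_of_integral_eq_zero (X := id) (μ := gaussianReal 0 1) (by fun_prop)
        (by simp)
      rw [variance_id_gaussianReal] at hv
      simpa using hv.symm)
  have h3 := (h1.sub hg).comp_tendsto (k := fun t : ℝ => σ * t) (l' := 𝓝 0)
    (by simpa using (continuous_const_mul σ).tendsto 0)
  have h4 : (fun t : ℝ => charFun (P.map X) t - Complex.exp (-((σ * t) ^ 2 / 2 : ℝ)))
      =o[𝓝 0] fun t => (σ * t) ^ 2 := by
    refine h3.congr (fun t => ?_) fun t => rfl
    simp only [Function.comp_apply, Measure.map_id, charFun_gaussianReal, charFun_map_mul_comp hX]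
    rw [inv_mul_cancel_left₀ hσ.ne']
    push_cast
    simp
  refine h4.trans_isBigO ?_
  simp only [mul_pow]
  exact Asymptotics.isBigO_const_mul_self _ _ _

/-- Characteristic functions of weighted sums with uniformly small weights converge to those of a
Gaussian law. -/
theorem tendsto_prod_charFun {X : Ω → ℝ} {σ : ℝ} (hσ : 0 < σ) (hX : AEMeasurable X P)
    (h0 : ∫ ω, X ω ∂P = 0) (h2 : variance X P = σ ^ 2) {s : (n : ℕ) → Fin n → ℝ} {v : ℝ}
    (hsmall : ∀ δ > 0, ∀ᶠ n in atTop, ∀ i, |s n i| ≤ δ)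
    (hsum : Tendsto (fun n => ∑ i, s n i ^ 2) atTop (𝓝 v)) :
    Tendsto (fun n => ∏ i, charFun (P.map X) (s n i)) atTop
      (𝓝 (Complex.exp (-(σ ^ 2 * v / 2 : ℝ)))) := by
  have : IsProbabilityMeasure (P.map X) := Measure.isProbabilityMeasure_map hX
  have hexp : Tendsto (fun n => ∏ i, Complex.exp (-((σ * s n i) ^ 2 / 2 : ℝ))) atTop
      (𝓝 (Complex.exp (-(σ ^ 2 * v / 2 : ℝ)))) := by
    have h1 : ∀ n, ∏ i, Complex.exp (-((σ * s n i) ^ 2 / 2 : ℝ)) =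
        Complex.exp (-(σ ^ 2 * (∑ i, s n i ^ 2) / 2 : ℝ)) := fun n => by
      rw [← Complex.exp_sum, Finset.mul_sum, Finset.sum_div]
      push_cast
      rw [Finset.sum_neg_distrib]
      simp only [mul_pow]
    simp only [h1]
    have h3 : Continuous fun y : ℝ => Complex.exp (-(σ ^ 2 * y / 2 : ℝ)) := by fun_prop
    exact (h3.tendsto v).comp hsum
  suffices h : Tendsto (fun n => ∏ i, charFun (P.map X) (s n i) -
      ∏ i, Complex.exp (-((σ * s n i) ^ 2 / 2 : ℝ))) atTop (𝓝 0) by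
    simpa using h.add hexp
  rw [Metric.tendsto_nhds]
  intro η hη
  have hv : 0 < |v| + 1 := by positivity
  -- The squared weights eventually sum to less than `|v| + 1`, so this constant gives a total error
  -- of at most `η / 2`.
  have hsmall' := Asymptotics.isLittleO_iff.mp (charFun_sub_exp_isLittleO hσ hX h0 h2)
    (show 0 < η / 2 / (|v| + 1) by positivity)
  obtain ⟨δ, hδ, hball⟩ := Metric.eventually_nhds_iff.mp hsmall'
  filter_upwards [hsmall (δ / 2) (by positivity),
    hsum.eventually_lt_const (show v < |v| + 1 by linarith [le_abs_self v])] with n hn hn'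
  rw [dist_zero_right]
  calc ‖∏ i, charFun (P.map X) (s n i) - ∏ i, Complex.exp (-((σ * s n i) ^ 2 / 2 : ℝ))‖
      ≤ ∑ i, ‖charFun (P.map X) (s n i) - Complex.exp (-((σ * s n i) ^ 2 / 2 : ℝ))‖ := by
        refine norm_prod_sub_prod_le_sum _ (fun i => norm_charFun_le_one _) fun i => ?_
        rw [← Complex.ofReal_neg, Complex.norm_exp_ofReal, Real.exp_le_one_iff]
        linarith [show 0 ≤ (σ * s n i) ^ 2 / 2 by positivity]
    _ ≤ ∑ i, η / 2 / (|v| + 1) * s n i ^ 2 := by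
        refine Finset.sum_le_sum fun i _ => ?_
        have := hball (y := s n i) (by
          rw [Real.dist_eq, sub_zero]; linarith [hn i])
        rwa [Real.norm_of_nonneg (sq_nonneg _)] at this
    _ ≤ η / 2 / (|v| + 1) * (|v| + 1) := by
        rw [← Finset.mul_sum]
        gcongr
    _ < η := by
        rw [div_mul_cancel₀ _ hv.ne']
        linarith

end WeightedSums

/-! ### Consequences of the convergence of the Gram matrices -/

/-- A term divided by `n` is a difference of consecutive averages, up to the factor `(n + 1) / n`,
so it tends to zero. The finitely many early terms are dominated as `n` grows. -/
theorem eventually_forall_le_of_tendsto_average {a : ℕ → ℝ} {c : ℝ}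
    (h : Tendsto (fun n : ℕ => (n : ℝ)⁻¹ * ∑ i ∈ Finset.range n, a i) atTop (𝓝 c)) {δ : ℝ}
    (hδ : 0 < δ) : ∀ᶠ n : ℕ in atTop, ∀ i < n, a i ≤ δ * n := by
  have h1 : Tendsto (fun n : ℕ => a n / n) atTop (𝓝 0) := by
    have h2 : Tendsto (fun n : ℕ => ((n + 1 : ℕ) : ℝ) / n) atTop (𝓝 1) := by
      have h3 := (tendsto_one_div_atTop_nhds_zero_nat (𝕜 := ℝ)).const_add 1
      rw [add_zero] at h3
      refine h3.congr' ?_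
      filter_upwards [eventually_gt_atTop 0] with n hn
      have hn' : (n : ℝ) ≠ 0 := by positivity
      field_simp
      push_cast
      ring
    have h3 := ((h.comp (tendsto_add_atTop_nat 1)).mul h2).sub h
    simp only [mul_one, sub_self] at h3
    refine h3.congr' ?_
    filter_upwards [eventually_gt_atTop 0] with n hn
    have hn' : (n : ℝ) ≠ 0 := by positivity
    simp only [Function.comp_apply, Finset.sum_range_succ]
    push_cast
    field_simp
    ring
  obtain ⟨N, hN⟩ := eventually_atTop.mp
    ((h1.eventually (gt_mem_nhds hδ)).and (eventually_gt_atTop 0))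
  have hfin : ∀ᶠ n : ℕ in atTop, ∀ i ∈ Finset.range N, a i ≤ δ * n := by
    rw [Filter.eventually_all_finset]
    intro i _
    exact (tendsto_natCast_atTop_atTop.const_mul_atTop hδ).eventually_ge_atTop _
  filter_upwards [hfin] with n hn i hi
  rcases lt_or_ge i N with h4 | h4
  · exact hn i (Finset.mem_range.mpr h4)
  · obtain ⟨h5, h6⟩ := hN i h4
    have h7 : (0 : ℝ) < i := by exact_mod_cast h6
    rw [div_lt_iff₀ h7] at h5
    have h8 : (i : ℝ) ≤ n := by exact_mod_cast hi.le
    nlinarith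

theorem gramMatrix_apply {p : ℕ} (x : ℕ → Fin p → ℝ) (n : ℕ) (j k : Fin p) :
    gramMatrix x n j k = (n : ℝ)⁻¹ * ∑ i ∈ Finset.range n, x i j * x i k := by
  rw [← Fin.sum_univ_eq_sum_range (fun i => x i j * x i k)]
  simp [gramMatrix, mul_apply, designMatrix]

theorem gramMatrix_transpose {p : ℕ} (x : ℕ → Fin p → ℝ) (n : ℕ) :
    (gramMatrix x n)ᵀ = gramMatrix x n := by
  rw [gramMatrix, transpose_smul, transpose_mul, transpose_transpose]

theorem gramMatrix_posSemidef {p : ℕ} (x : ℕ → Fin p → ℝ) (n : ℕ) :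
    (gramMatrix x n).PosSemidef := by
  have := (posSemidef_conjTranspose_mul_self (designMatrix x n)).smul
    (show (0 : ℝ) ≤ (n : ℝ)⁻¹ by positivity)
  rwa [conjTranspose_eq_transpose_of_trivial] at this

theorem score_dotProduct {p : ℕ} (x : ℕ → Fin p → ℝ) (n : ℕ) (e : Fin n → ℝ) (τ : Fin p → ℝ) :
    score x n e ⬝ᵥ τ = ∑ i : Fin n, ((√(n : ℝ))⁻¹ * (x i ⬝ᵥ τ)) * e i := by
  have h : (designMatrix x n *ᵥ τ) = fun i : Fin n => x i ⬝ᵥ τ := rfl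
  rw [score, smul_dotProduct, mulVec_transpose, ← dotProduct_mulVec, h, dotProduct, Finset.smul_sum]
  refine Finset.sum_congr rfl fun i _ => ?_
  simp only [smul_eq_mul]
  ring

theorem inner_orthantSolution {p : ℕ} {G : Matrix (Fin p) (Fin p) ℝ} (hG : Gᵀ = G)
    (L d w : Fin p → ℝ) (t : EuclideanSpace ℝ (Fin p)) :
    inner ℝ (WithLp.toLp 2 (orthantSolution G L d w)) t =
      w ⬝ᵥ (G⁻¹ *ᵥ t.ofLp) - (L * d) ⬝ᵥ (G⁻¹ *ᵥ t.ofLp) := by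
  have hG' : (G⁻¹)ᵀ = G⁻¹ := by rw [transpose_nonsing_inv, hG]
  rw [EuclideanSpace.inner_eq_star_dotProduct, star_trivial, orthantSolution, dotProduct_mulVec,
    ← mulVec_transpose, hG', dotProduct_comm, sub_dotProduct]

theorem inner_neg_inv_mulVec {p : ℕ} {C : Matrix (Fin p) (Fin p) ℝ} (hC : Cᵀ = C)
    (lam d : Fin p → ℝ) (t : EuclideanSpace ℝ (Fin p)) :
    inner ℝ t (WithLp.toLp 2 (-(C⁻¹ *ᵥ (diagonal lam *ᵥ d)))) =
      -((lam * d) ⬝ᵥ (C⁻¹ *ᵥ t.ofLp)) := by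
  have hC' : (C⁻¹)ᵀ = C⁻¹ := by rw [transpose_nonsing_inv, hC]
  have hm : diagonal lam *ᵥ d = lam * d := by ext j; simp [mulVec_diagonal]
  rw [EuclideanSpace.inner_eq_star_dotProduct, star_trivial, hm, neg_dotProduct, dotProduct_comm,
    dotProduct_mulVec, ← mulVec_transpose, hC', dotProduct_comm]

/-- The sum of squared weights of the errors in a linear functional of the orthant solution. -/
theorem sum_sq_weights {p : ℕ} {x : ℕ → Fin p → ℝ} {n : ℕ} (hG : IsUnit (gramMatrix x n).det)
    (t : Fin p → ℝ) :
    ∑ i : Fin n, ((√(n : ℝ))⁻¹ * (x i ⬝ᵥ ((gramMatrix x n)⁻¹ *ᵥ t))) ^ 2 =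
      t ⬝ᵥ (gramMatrix x n)⁻¹ *ᵥ t := by
  set τ := (gramMatrix x n)⁻¹ *ᵥ t with hτ
  have h1 : τ ⬝ᵥ gramMatrix x n *ᵥ τ = t ⬝ᵥ τ := by
    rw [hτ, mulVec_mulVec, mul_nonsing_inv _ hG, one_mulVec, dotProduct_comm]
  have h2 : τ ⬝ᵥ gramMatrix x n *ᵥ τ = (n : ℝ)⁻¹ * ∑ i : Fin n, (x i ⬝ᵥ τ) ^ 2 := by
    rw [gramMatrix, smul_mulVec, dotProduct_smul, ← mulVec_mulVec, dotProduct_mulVec,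
      vecMul_transpose, smul_eq_mul]
    congr 1
    exact Finset.sum_congr rfl fun i _ => (sq _).symm
  rw [← h1, h2, Finset.mul_sum]
  refine Finset.sum_congr rfl fun i _ => ?_
  rw [mul_pow, inv_pow, Real.sq_sqrt (Nat.cast_nonneg n)]

section Design

variable {p : ℕ} {x : ℕ → Fin p → ℝ} {C : Matrix (Fin p) (Fin p) ℝ}

theorem eventually_posDef_gramMatrix (hC : C.PosDef) (hX : Tendsto (gramMatrix x) atTop (𝓝 C)) :
    ∀ᶠ n in atTop, (gramMatrix x n).PosDef := by
  have h1 : Tendsto (fun n => (gramMatrix x n).det) atTop (𝓝 C.det) :=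
    ((continuous_id.matrix_det).tendsto C).comp hX
  filter_upwards [h1.eventually_ne hC.det_pos.ne'] with n hn
  exact (gramMatrix_posSemidef x n).posDef_iff_isUnit.mpr
    ((isUnit_iff_isUnit_det _).mpr hn.isUnit)

theorem tendsto_inv_gramMatrix (hC : C.PosDef) (hX : Tendsto (gramMatrix x) atTop (𝓝 C)) :
    Tendsto (fun n => (gramMatrix x n)⁻¹) atTop (𝓝 C⁻¹) := by
  have h : ContinuousAt Ring.inverse C.det := by
    simpa [Ring.inverse_eq_inv'] using continuousAt_inv₀ hC.det_pos.ne'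
  exact (continuousAt_matrix_inv C h).tendsto.comp hX

/-- The negligibility condition of the central limit theorem. Convergence of the diagonal Gram
entries alone forces `x i j ^ 2 / n` to be small uniformly in `i < n`. -/
theorem eventually_abs_weight_le (hX : Tendsto (gramMatrix x) atTop (𝓝 C))
    {τ : ℕ → Fin p → ℝ} {τ₀ : Fin p → ℝ} (hτ : Tendsto τ atTop (𝓝 τ₀)) {δ : ℝ} (hδ : 0 < δ) :
    ∀ᶠ n : ℕ in atTop, ∀ i : Fin n, |(√(n : ℝ))⁻¹ * (x i ⬝ᵥ τ n)| ≤ δ := by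
  have hB : 0 < ∑ j, |τ₀ j| + 1 := by positivity
  set η := δ / (∑ j, |τ₀ j| + 1) with hη
  have hη0 : 0 < η := div_pos hδ hB
  have h1 : ∀ᶠ n : ℕ in atTop, ∀ j, ∀ i < n, x i j * x i j ≤ η ^ 2 * n := by
    rw [Filter.eventually_all]
    intro j
    refine eventually_forall_le_of_tendsto_average (c := C j j) ?_ (by positivity)
    simp only [← gramMatrix_apply]
    exact ((continuous_id.matrix_elem j j).tendsto C).comp hX
  have h2 : Tendsto (fun n => ∑ j, |τ n j|) atTop (𝓝 (∑ j, |τ₀ j|)) :=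
    tendsto_finsetSum _ fun j _ => (tendsto_pi_nhds.mp hτ j).abs
  filter_upwards [h1, h2.eventually_lt_const (lt_add_one _), eventually_gt_atTop 0]
    with n hn hn' hn0 i
  have hs : 0 < √(n : ℝ) := Real.sqrt_pos.mpr (by exact_mod_cast hn0)
  have hx : ∀ j, |x i j| ≤ η * √(n : ℝ) := fun j => by
    refine abs_le_of_sq_le_sq ?_ (by positivity)
    rw [mul_pow, Real.sq_sqrt (Nat.cast_nonneg n), sq]
    exact hn j i i.2
  rw [abs_mul, abs_of_pos (inv_pos.mpr hs), inv_mul_le_iff₀ hs]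
  calc |x i ⬝ᵥ τ n| ≤ ∑ j, |x i j * τ n j| := Finset.abs_sum_le_sum_abs _ _
    _ ≤ ∑ j, η * √(n : ℝ) * |τ n j| := by
        refine Finset.sum_le_sum fun j _ => ?_
        rw [abs_mul]
        gcongr
        exact hx j
    _ = η * √(n : ℝ) * ∑ j, |τ n j| := by rw [Finset.mul_sum]
    _ ≤ η * √(n : ℝ) * (∑ j, |τ₀ j| + 1) := by gcongr
    _ = √(n : ℝ) * δ := by
        rw [hη]
        field_simp

end Design

/-! ### Limit laws of the orthant solutions -/

section Law

variable {p : ℕ} {Ω : Type*} [MeasurableSpace Ω] {P : Measure Ω} {ε : ℕ → Ω → ℝ}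

theorem continuous_orthantSolution (G : Matrix (Fin p) (Fin p) ℝ) (L d : Fin p → ℝ) :
    Continuous fun w : Fin p → ℝ => WithLp.toLp 2 (orthantSolution G L d w) :=
  (PiLp.continuous_toLp _ _).comp
    (continuous_const.matrix_mulVec (continuous_id.sub continuous_const))

theorem aemeasurable_orthantSolution (hε : ∀ i, AEMeasurable (ε i) P) (x : ℕ → Fin p → ℝ) (n : ℕ)
    (G : Matrix (Fin p) (Fin p) ℝ) (L d : Fin p → ℝ) :
    AEMeasurable (fun ω => WithLp.toLp 2 (orthantSolution G L d (score x n fun i => ε i ω))) P := by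
  have h' : Continuous fun e : Fin n → ℝ => (designMatrix x n)ᵀ *ᵥ e :=
    continuous_const.matrix_mulVec continuous_id
  have h : Continuous fun e : Fin n → ℝ => score x n e := by
    unfold score
    fun_prop
  exact ((continuous_orthantSolution G L d).comp h).measurable.comp_aemeasurable
    (aemeasurable_pi_lambda _ fun i => hε i)

/-- Cramér–Wold reduction to a scalar variable, with the deterministic shift split off as a phase.
-/
theorem charFun_map_of_inner_eq {Y : Ω → EuclideanSpace ℝ (Fin p)} {Z : Ω → ℝ}
    (hY : AEMeasurable Y P) (hZ : AEMeasurable Z P) {t : EuclideanSpace ℝ (Fin p)} {c : ℝ}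
    (h : ∀ ω, inner ℝ (Y ω) t = Z ω - c) :
    charFun (P.map Y) t = Complex.exp (-(c * Complex.I)) * charFun (P.map Z) 1 := by
  rw [charFun_apply, integral_map hY (by fun_prop), charFun_apply_real, integral_map hZ (by fun_prop),
    ← integral_const_mul]
  refine integral_congr_ae (.of_forall fun ω => ?_)
  simp only [h, ← Complex.exp_add]
  push_cast
  ring_nf

theorem charFun_orthantSolution (hindep : iIndepFun ε P)
    (hident : ∀ i, IdentDistrib (ε i) (ε 0) P P) (x : ℕ → Fin p → ℝ) (n : ℕ)
    {G : Matrix (Fin p) (Fin p) ℝ} (hG : Gᵀ = G) (L d : Fin p → ℝ)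
    (t : EuclideanSpace ℝ (Fin p)) :
    charFun (P.map fun ω => WithLp.toLp 2 (orthantSolution G L d (score x n fun i => ε i ω))) t =
      Complex.exp (-(((L * d) ⬝ᵥ (G⁻¹ *ᵥ t.ofLp) : ℝ) * Complex.I)) *
        ∏ i : Fin n, charFun (P.map (ε 0)) ((√(n : ℝ))⁻¹ * (x i ⬝ᵥ (G⁻¹ *ᵥ t.ofLp))) := by
  have hε : ∀ i, AEMeasurable (ε i) P := fun i => (hident i).aemeasurable_fst
  set s : Fin n → ℝ := fun i => (√(n : ℝ))⁻¹ * (x i ⬝ᵥ (G⁻¹ *ᵥ t.ofLp)) with hs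
  have hm : ∀ i : Fin n, AEMeasurable (fun ω => s i * ε i ω) P := fun i => (hε i).const_mul _
  rw [charFun_map_of_inner_eq (Z := fun ω => ∑ i : Fin n, s i * ε i ω)
    (aemeasurable_orthantSolution hε x n G L d) (Finset.aemeasurable_fun_sum _ fun i _ => hm i)
    fun ω => by rw [inner_orthantSolution hG, score_dotProduct]]
  have hind : iIndepFun (fun (i : Fin n) ω => s i * ε i ω) P :=
    (hindep.precomp Fin.val_injective).comp (fun i y => s i * y) fun i => by fun_prop
  rw [hind.charFun_map_fun_sum_eq_prod hm, Finset.prod_apply]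
  congr 1
  refine Finset.prod_congr rfl fun i _ => ?_
  rw [charFun_map_mul_comp (hε i), mul_one, (hident i).map_eq]

theorem hasLaw_limitMinimizer {C : Matrix (Fin p) (Fin p) ℝ} (hC : C.PosDef) (σ : ℝ)
    (lam d : Fin p → ℝ) :
    HasLaw (limitMinimizer C lam d)
      (multivariateGaussian (WithLp.toLp 2 (-(C⁻¹ *ᵥ (diagonal lam *ᵥ d)))) (σ ^ 2 • C⁻¹))
      (multivariateGaussian (0 : EuclideanSpace ℝ (Fin p)) (σ ^ 2 • C)) := by
  have hdet : IsUnit C.det := (isUnit_iff_isUnit_det C).mp hC.isUnit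
  have hT : Cᵀ = C := hC.isHermitian
  have hcont : Continuous (limitMinimizer C lam d) := by
    rw [funext (limitMinimizer_eq hC lam d)]
    exact (continuous_orthantSolution C lam d).comp (PiLp.continuous_ofLp _ _)
  refine ⟨hcont.aemeasurable, ?_⟩
  have : IsProbabilityMeasure ((multivariateGaussian (0 : EuclideanSpace ℝ (Fin p))
      (σ ^ 2 • C)).map (limitMinimizer C lam d)) :=
    Measure.isProbabilityMeasure_map hcont.aemeasurable
  refine Measure.ext_of_charFun (funext fun t => ?_)
  set τ : EuclideanSpace ℝ (Fin p) := WithLp.toLp 2 (C⁻¹ *ᵥ t.ofLp) with hτ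
  rw [charFun_map_of_inner_eq (Z := fun w => inner ℝ w τ) (c := (lam * d) ⬝ᵥ (C⁻¹ *ᵥ t.ofLp))
    hcont.aemeasurable (by fun_prop) fun w => by
      rw [limitMinimizer_eq hC, inner_orthantSolution hT, EuclideanSpace.inner_eq_star_dotProduct,
        star_trivial, hτ, dotProduct_comm w.ofLp]]
  have h1 : charFun ((multivariateGaussian (0 : EuclideanSpace ℝ (Fin p)) (σ ^ 2 • C)).map
      fun w => inner ℝ w τ) 1 =
      charFun (multivariateGaussian (0 : EuclideanSpace ℝ (Fin p)) (σ ^ 2 • C)) τ := by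
    rw [charFun_apply_real, integral_map (by fun_prop) (by fun_prop), charFun_apply]
    simp
  rw [h1, charFun_multivariateGaussian (hC.posSemidef.smul (sq_nonneg σ)),
    charFun_multivariateGaussian (hC.inv.posSemidef.smul (sq_nonneg σ)), ← Complex.exp_add]
  have h2 : τ.ofLp ⬝ᵥ (σ ^ 2 • C) *ᵥ τ.ofLp = t.ofLp ⬝ᵥ (σ ^ 2 • C⁻¹) *ᵥ t.ofLp := by
    simp only [hτ, smul_mulVec, dotProduct_smul]
    rw [mulVec_mulVec, mul_nonsing_inv _ hdet, one_mulVec, dotProduct_comm]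
  rw [h2, inner_neg_inv_mulVec hT, inner_zero_right]
  congr 1
  push_cast
  ring

/-- Central limit theorem for the orthant solutions. -/
theorem tendsto_charFun_orthantSolution [IsProbabilityMeasure P] {σ : ℝ} (hσ : 0 < σ)
    (hindep : iIndepFun ε P) (hident : ∀ i, IdentDistrib (ε i) (ε 0) P P)
    (hmean : ∫ ω, ε 0 ω ∂P = 0) (hvar : variance (ε 0) P = σ ^ 2) {x : ℕ → Fin p → ℝ}
    {C : Matrix (Fin p) (Fin p) ℝ} (hC : C.PosDef) (hX : Tendsto (gramMatrix x) atTop (𝓝 C))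
    {L : ℕ → Fin p → ℝ} {lam : Fin p → ℝ} (hL : Tendsto L atTop (𝓝 lam)) (d : Fin p → ℝ)
    (t : EuclideanSpace ℝ (Fin p)) :
    Tendsto (fun n => charFun (P.map fun ω => WithLp.toLp 2
        (orthantSolution (gramMatrix x n) (L n) d (score x n fun i => ε i ω))) t) atTop
      (𝓝 (charFun (multivariateGaussian (WithLp.toLp 2 (-(C⁻¹ *ᵥ (diagonal lam *ᵥ d))))
        (σ ^ 2 • C⁻¹)) t)) := by
  have hτ : Tendsto (fun n => (gramMatrix x n)⁻¹ *ᵥ t.ofLp) atTop (𝓝 (C⁻¹ *ᵥ t.ofLp)) :=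
    ((continuous_id.matrix_mulVec continuous_const).tendsto C⁻¹).comp
      (tendsto_inv_gramMatrix hC hX)
  have hc : Tendsto (fun n => (L n * d) ⬝ᵥ ((gramMatrix x n)⁻¹ *ᵥ t.ofLp)) atTop
      (𝓝 ((lam * d) ⬝ᵥ (C⁻¹ *ᵥ t.ofLp))) :=
    ((continuous_fst.mul continuous_const).dotProduct continuous_snd |>.tendsto
      (lam, C⁻¹ *ᵥ t.ofLp)).comp (hL.prodMk_nhds hτ)
  have hsq : Tendsto (fun n : ℕ => ∑ i : Fin n,
      ((√(n : ℝ))⁻¹ * (x i ⬝ᵥ ((gramMatrix x n)⁻¹ *ᵥ t.ofLp))) ^ 2) atTop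
      (𝓝 (t.ofLp ⬝ᵥ C⁻¹ *ᵥ t.ofLp)) := by
    have h1 : Tendsto (fun n => t.ofLp ⬝ᵥ (gramMatrix x n)⁻¹ *ᵥ t.ofLp) atTop
        (𝓝 (t.ofLp ⬝ᵥ C⁻¹ *ᵥ t.ofLp)) :=
      ((continuous_const.dotProduct continuous_id).tendsto (C⁻¹ *ᵥ t.ofLp)).comp hτ
    refine h1.congr' ?_
    filter_upwards [eventually_posDef_gramMatrix hC hX] with n hn
    rw [sum_sq_weights hn.det_pos.ne'.isUnit]
  have hprod := tendsto_prod_charFun hσ (hident 0).aemeasurable_fst hmean hvar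
    (s := fun n i => (√(n : ℝ))⁻¹ * (x i ⬝ᵥ ((gramMatrix x n)⁻¹ *ᵥ t.ofLp)))
    (fun δ hδ => eventually_abs_weight_le hX hτ hδ) hsq
  have hexp : Tendsto (fun n => Complex.exp
      (-(((L n * d) ⬝ᵥ ((gramMatrix x n)⁻¹ *ᵥ t.ofLp) : ℝ) * Complex.I))) atTop
      (𝓝 (Complex.exp (-(((lam * d) ⬝ᵥ (C⁻¹ *ᵥ t.ofLp) : ℝ) * Complex.I)))) := by
    have h3 : Continuous fun y : ℝ => Complex.exp (-(y * Complex.I)) := by fun_prop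
    exact (h3.tendsto _).comp hc
  simp only [charFun_orthantSolution hindep hident x _ (gramMatrix_transpose x _)]
  convert hexp.mul hprod using 2
  rw [charFun_multivariateGaussian (hC.inv.posSemidef.smul (sq_nonneg σ)), ← Complex.exp_add]
  rw [inner_neg_inv_mulVec (C := C) hC.isHermitian, smul_mulVec, dotProduct_smul, smul_eq_mul]
  congr 1
  push_cast
  ring

end Law

/-! ### Coverage bounds -/

theorem signVectors.abs_eq_one {p : ℕ} {d : Fin p → ℝ} (hd : d ∈ signVectors p) (j : Fin p) :
    |d j| = 1 := by
  rcases hd j with h | h <;> simp [h]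

theorem exists_signVector_mul_nonneg {p : ℕ} (b : Fin p → ℝ) :
    ∃ d ∈ signVectors p, ∀ j, 0 ≤ d j * b j := by
  classical
  refine ⟨fun j => if 0 ≤ b j then 1 else -1, fun j => ?_, fun j => ?_⟩
  · by_cases h : 0 ≤ b j <;> simp [h]
  · by_cases h : 0 ≤ b j
    · simp [h]
    · simpa [h] using (not_le.mp h).le

theorem norm_toLp_le_sum_abs {p : ℕ} (v : Fin p → ℝ) : ‖WithLp.toLp 2 v‖ ≤ ∑ j, |v j| := by
  have h : WithLp.toLp 2 v = ∑ j, EuclideanSpace.single j (v j) := by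
    ext j; simp [Finset.sum_apply, Pi.single_apply]
  rw [h]
  refine (norm_sum_le _ _).trans (le_of_eq ?_)
  simp

/-- The set of points at distance more than `δ` from the complement of `M`. -/
def deepInterior {E : Type*} [PseudoEMetricSpace E] (M : Set E) (δ : ℝ) : Set E :=
  {u | ENNReal.ofReal δ < Metric.infEDist u Mᶜ}

theorem isOpen_deepInterior {E : Type*} [PseudoEMetricSpace E] (M : Set E) (δ : ℝ) :
    IsOpen (deepInterior M δ) :=
  isOpen_lt continuous_const Metric.continuous_infEDist

theorem add_mem_of_mem_deepInterior {E : Type*} [SeminormedAddCommGroup E] {M : Set E} {δ : ℝ}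
    {u v : E} (hu : u ∈ deepInterior M δ) (hv : ‖v‖ ≤ δ) : u + v ∈ M := by
  by_contra hmem
  have h1 := Metric.infEDist_le_edist_of_mem (x := u) (s := Mᶜ) hmem
  have h2 : edist u (u + v) ≤ ENNReal.ofReal δ := by
    rw [edist_dist, dist_self_add_right]
    exact ENNReal.ofReal_le_ofReal hv
  exact absurd (hu.trans_le (h1.trans h2)) (lt_irrefl _)

/-- Continuity from below, as the deep interiors increase to `interior M`. The extended distance
also covers an empty complement. -/
theorem exists_lt_measure_deepInterior {E : Type*} [PseudoEMetricSpace E] [MeasurableSpace E]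
    {ν : Measure E} {M : Set E} {c : ENNReal} (h : c < ν (interior M)) :
    ∃ δ > 0, c < ν (deepInterior M δ) := by
  have hU : interior M = ⋃ k : ℕ, deepInterior M (1 / ((k : ℝ) + 1)) := by
    ext u
    rw [Set.mem_iUnion]
    have h1 : u ∈ interior M ↔ 0 < Metric.infEDist u Mᶜ := by
      rw [pos_iff_ne_zero, ne_eq, ← Metric.mem_closure_iff_infEDist_zero, closure_compl,
        Set.notMem_compl_iff]
    rw [h1]
    constructor
    · intro hpos
      have h2 : Tendsto (fun k : ℕ => ENNReal.ofReal (1 / ((k : ℝ) + 1))) atTop (𝓝 0) := by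
        simpa [Function.comp_def] using (ENNReal.continuous_ofReal.tendsto 0).comp
          (tendsto_one_div_add_atTop_nhds_zero_nat (𝕜 := ℝ))
      exact (h2.eventually_lt_const hpos).exists
    · rintro ⟨k, hk⟩
      exact zero_le.trans_lt hk
  have hmono : Monotone fun k : ℕ => deepInterior M (1 / ((k : ℝ) + 1)) := fun k l hkl u hu =>
    lt_of_le_of_lt (ENNReal.ofReal_le_ofReal (by gcongr)) hu
  rw [hU, hmono.measure_iUnion, lt_iSup_iff] at h
  obtain ⟨k, hk⟩ := h
  exact ⟨_, by positivity, hk⟩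

section Coverage

variable {p : ℕ} {x : ℕ → Fin p → ℝ} {C : Matrix (Fin p) (Fin p) ℝ} {L : ℕ → Fin p → ℝ}
  {lam : Fin p → ℝ}

/-- The matrix tends to zero and the vector is bounded by `2 * L n`, whatever the admissible `g`;
hence the uniformity in the parameter and the errors. -/
theorem eventually_norm_correction_le (hC : C.PosDef) (hX : Tendsto (gramMatrix x) atTop (𝓝 C))
    (hL : Tendsto L atTop (𝓝 lam)) {δ : ℝ} (hδ : 0 < δ) :
    ∀ᶠ n in atTop, ∀ d ∈ signVectors p, ∀ g : Fin p → ℝ, (∀ j, |g j| ≤ L n j) →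
      ‖WithLp.toLp 2 ((C⁻¹ * (C - gramMatrix x n) * (gramMatrix x n)⁻¹) *ᵥ (L n * d - g))‖ ≤ δ := by
  set B : ℕ → Matrix (Fin p) (Fin p) ℝ := fun n =>
    C⁻¹ * (C - gramMatrix x n) * (gramMatrix x n)⁻¹ with hB
  have hcont : Continuous fun q : Matrix (Fin p) (Fin p) ℝ × Matrix (Fin p) (Fin p) ℝ =>
      C⁻¹ * (C - q.1) * q.2 := by fun_prop
  have hB0 : Tendsto B atTop (𝓝 0) := by
    have := (hcont.tendsto (C, C⁻¹)).comp (hX.prodMk_nhds (tendsto_inv_gramMatrix hC hX))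
    simpa [Function.comp_def, hB] using this
  have hlim : Tendsto (fun n => ∑ j, ∑ k, |B n j k| * (2 * L n k)) atTop (𝓝 0) := by
    have h1 : Tendsto (fun n => ∑ j, ∑ k, |B n j k| * (2 * L n k)) atTop
        (𝓝 (∑ j : Fin p, ∑ k, |(0 : Matrix (Fin p) (Fin p) ℝ) j k| * (2 * lam k))) :=
      tendsto_finsetSum _ fun j _ => tendsto_finsetSum _ fun k _ =>
        ((((continuous_id.matrix_elem j k).tendsto _).comp hB0).abs).mul
          ((tendsto_pi_nhds.mp hL k).const_mul 2)
    simpa using h1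
  filter_upwards [hlim.eventually_le_const hδ] with n hn d hd g hg
  refine (norm_toLp_le_sum_abs _).trans (le_trans ?_ hn)
  refine Finset.sum_le_sum fun j _ =>
    (Finset.abs_sum_le_sum_abs (fun k => B n j k * (L n * d - g) k) Finset.univ).trans ?_
  refine Finset.sum_le_sum fun k _ => ?_
  rw [abs_mul]
  refine mul_le_mul_of_nonneg_left ?_ (abs_nonneg _)
  have hL0 : 0 ≤ L n k := (abs_nonneg _).trans (hg k)
  have h1 : |L n k * d k| = L n k := by
    rw [abs_mul, signVectors.abs_eq_one hd, mul_one, abs_of_nonneg hL0]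
  have h2 : |(L n * d - g) k| ≤ |L n k * d k| + |g k| := abs_sub _ _
  linarith [hg k]

/-- Uniform lower bound for the coverage in terms of the orthant solutions. -/
theorem deepInterior_subset_coverage {Ω : Type*} {ε : ℕ → Ω → ℝ}
    {M : Set (EuclideanSpace ℝ (Fin p))} (hC : C.PosDef) (hM : ConditionA C M) {n : ℕ} (hn : 0 < n)
    (hG : (gramMatrix x n).PosDef) {lamn : Fin p → ℝ} (hlamn : ∀ j, 0 ≤ lamn j) {δ : ℝ}
    (hδ : ∀ d ∈ signVectors p, ∀ g : Fin p → ℝ, (∀ j, |g j| ≤ lamn j / √(n : ℝ)) →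
      ‖WithLp.toLp 2 ((C⁻¹ * (C - gramMatrix x n) * (gramMatrix x n)⁻¹) *ᵥ
        ((fun j => lamn j / √(n : ℝ)) * d - g))‖ ≤ δ)
    {d : Fin p → ℝ} (hd : d ∈ signVectors p) (β : EuclideanSpace ℝ (Fin p))
    (hdβ : ∀ j, 0 ≤ d j * β j) :
    {ω | WithLp.toLp 2 (orthantSolution (gramMatrix x n) (fun j => lamn j / √(n : ℝ)) d
        (score x n fun i => ε i ω)) ∈ deepInterior M δ} ⊆
      {ω | β ∈ confidenceSet n M
        (lassoEstimator (designMatrix x n) lamn (response x ε n β ω))} := by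
  intro ω hω
  have hunit := hG.det_pos.ne'.isUnit
  obtain ⟨g, hsol⟩ := exists_isLassoSolution hn hunit hlamn ε β ω
  refine (mem_confidenceSet_iff hn).mpr ?_
  refine hsol.mem_of_conditionA hunit hC.det_pos.ne'.isUnit hM hd (fun j => ?_)
    (add_mem_of_mem_deepInterior hω (hδ d hd g hsol.bound))
  have := mul_nonneg (Real.sqrt_nonneg (n : ℝ)) (hdβ j)
  simp only [WithLp.ofLp_smul, Pi.smul_apply, smul_eq_mul]
  linarith

variable {Ω : Type*} [MeasurableSpace Ω] {P : Measure Ω} [IsProbabilityMeasure P] {ε : ℕ → Ω → ℝ}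
  {M : Set (EuclideanSpace ℝ (Fin p))}

/-- Letting all components of the parameter tend to `±∞` shows that the minimal coverage is at most
that of an orthant solution. -/
theorem iInf_coverage_le (hε : ∀ i, AEMeasurable (ε i) P) {n : ℕ} (hn : 0 < n)
    (hG : (gramMatrix x n).PosDef) {lamn : Fin p → ℝ} (hlamn : ∀ j, 0 ≤ lamn j) {d : Fin p → ℝ}
    (hd : d ∈ signVectors p) :
    ⨅ β : EuclideanSpace ℝ (Fin p), P.real {ω | β ∈ confidenceSet n M
        (lassoEstimator (designMatrix x n) lamn (response x ε n β ω))} ≤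
      P.real {ω | WithLp.toLp 2 (orthantSolution (gramMatrix x n) (fun j => lamn j / √(n : ℝ)) d
        (score x n fun i => ε i ω)) ∈ M} := by
  have hs : 0 < √(n : ℝ) := Real.sqrt_pos.mpr (by exact_mod_cast hn)
  set v : Ω → Fin p → ℝ := fun ω => orthantSolution (gramMatrix x n)
    (fun j => lamn j / √(n : ℝ)) d (score x n fun i => ε i ω) with hv
  have hvm : ∀ j, AEMeasurable (fun ω => v ω j) P := fun j => by
    have h1 := aemeasurable_orthantSolution hε x n (gramMatrix x n)
      (fun j => lamn j / √(n : ℝ)) d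
    exact (show Measurable fun u : EuclideanSpace ℝ (Fin p) => u j by fun_prop).comp_aemeasurable h1
  -- With `β = K d` one has `d j * t j = √n * K`; `B K` is the event that the shifted orthant
  -- solution leaves its open orthant. These events decrease to the empty set.
  let B : ℕ → Set Ω := fun K => {ω | ∃ j, d j * v ω j + √(n : ℝ) * K ≤ 0}
  have hBlim : Tendsto (fun K => P.real (B K)) atTop (𝓝 0) := by
    have hanti : Antitone B := fun K K' hK ω ⟨j, hj⟩ => ⟨j, by
      have : (K : ℝ) ≤ K' := by exact_mod_cast hK
      have := mul_le_mul_of_nonneg_left this hs.le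
      linarith⟩
    have hmeas : ∀ K, NullMeasurableSet (B K) P := fun K => by
      simp only [B, Set.ofPred_exists]
      exact NullMeasurableSet.iUnion fun j =>
        nullMeasurableSet_le (((hvm j).const_mul _).add_const _) aemeasurable_const
    have hempty : ⋂ K, B K = ∅ := by
      refine Set.eq_empty_of_forall_notMem fun ω hω => ?_
      have h1 : ∀ᶠ K : ℕ in atTop, ∀ j, - (d j * v ω j) < √(n : ℝ) * K := by
        rw [Filter.eventually_all]
        exact fun j => (tendsto_natCast_atTop_atTop.const_mul_atTop hs).eventually_gt_atTop _
      obtain ⟨K, hK⟩ := h1.exists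
      obtain ⟨j, hj⟩ := Set.mem_iInter.mp hω K
      linarith [hK j]
    have h2 := tendsto_measure_iInter_atTop (μ := P) hmeas hanti ⟨0, measure_ne_top _ _⟩
    rw [hempty, measure_empty] at h2
    simpa [Measure.real, Function.comp_def] using (ENNReal.tendsto_toReal ENNReal.zero_ne_top).comp h2
  have hbound : ∀ K : ℕ, ⨅ β : EuclideanSpace ℝ (Fin p), P.real {ω | β ∈ confidenceSet n M
        (lassoEstimator (designMatrix x n) lamn (response x ε n β ω))} ≤
      P.real {ω | WithLp.toLp 2 (v ω) ∈ M} + P.real (B K) := by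
    intro K
    refine (ciInf_le ⟨0, by rintro _ ⟨β, rfl⟩; exact measureReal_nonneg⟩
      (WithLp.toLp 2 ((K : ℝ) • d))).trans ?_
    refine (measureReal_mono ?_).trans (measureReal_union_le _ _)
    intro ω hω
    by_cases hB : ω ∈ B K
    · exact Or.inr hB
    left
    simp only [B, Set.mem_ofPred_eq, not_exists, not_le] at hB
    obtain ⟨g, hsol⟩ := exists_isLassoSolution hn hG.det_pos.ne'.isUnit hlamn ε
      (WithLp.toLp 2 ((K : ℝ) • d)) ω
    have heq := hsol.eq_orthantSolution hG hd fun j => by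
      have h1 : d j * d j = 1 := by rcases hd j with h | h <;> simp [h]
      have h2 : d j * (v ω j + √(n : ℝ) * (K * d j)) = d j * v ω j + √(n : ℝ) * K := by
        linear_combination √(n : ℝ) * K * h1
      have := hB j
      rw [← h2] at this
      simpa using this
    have hω' := (mem_confidenceSet_iff hn).mp hω
    rw [← WithLp.toLp_ofLp 2 (√(n : ℝ) • _), heq] at hω'
    exact hω'
  have := (tendsto_const_nhds (x := P.real {ω | WithLp.toLp 2 (v ω) ∈ M})).add hBlim
  rw [add_zero] at this
  exact ge_of_tendsto' this hbound

end Coverage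

/-! ### Combining the bounds -/

theorem mainTheorem3 {p : ℕ} {Ω : Type*} [MeasurableSpace Ω] (P : Measure Ω)
    [IsProbabilityMeasure P]
    -- the errors: i.i.d. with mean zero and finite variance `σ ^ 2`
    (ε : ℕ → Ω → ℝ) (σ : ℝ) (hσ : 0 < σ)
    (hindep : iIndepFun ε P) (hident : ∀ i, IdentDistrib (ε i) (ε 0) P P)
    (hL2 : MemLp (ε 0) 2 P) (hmean : ∫ ω, ε 0 ω ∂P = 0) (hvar : variance (ε 0) P = σ ^ 2)
    -- the rows of the regressor matrix
    (x : ℕ → Fin p → ℝ) (C : Matrix (Fin p) (Fin p) ℝ) (hC : C.PosDef)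
    (hX : Tendsto (gramMatrix x) atTop (𝓝 C))
    -- conservative tuning
    (lamn : ℕ → Fin p → ℝ) (hlamn : ∀ n j, 0 ≤ lamn n j) (lam : Fin p → ℝ)
    (hlam : ∀ j, Tendsto (fun n : ℕ => lamn n j / √(n : ℝ)) atTop (𝓝 (lam j)))
    -- the shape of the confidence set
    (M : Set (EuclideanSpace ℝ (Fin p))) (hM : ConditionA C M) (α : ℝ)
    (hmin : IsLeast
      ((fun d => (multivariateGaussian (0 : EuclideanSpace ℝ (Fin p)) (σ ^ 2 • C)).real
        {w | limitMinimizer C lam d w ∈ M}) '' signVectors p) (1 - α)) :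
    (∀ d ∈ signVectors p, HasLaw (limitMinimizer C lam d)
      (multivariateGaussian (WithLp.toLp 2 (-(C⁻¹ *ᵥ (Matrix.diagonal lam *ᵥ d)))) (σ ^ 2 • C⁻¹))
      (multivariateGaussian (0 : EuclideanSpace ℝ (Fin p)) (σ ^ 2 • C))) ∧
    liminf (fun n : ℕ => ⨅ β : EuclideanSpace ℝ (Fin p),
      P.real {ω | β ∈ confidenceSet n M
        (lassoEstimator (designMatrix x n) (lamn n) (response x ε n β ω))}) atTop = 1 - α := by
  refine ⟨fun d _ => hasLaw_limitMinimizer hC σ lam d, ?_⟩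
  have hε : ∀ i, AEMeasurable (ε i) P := fun i => (hident i).aemeasurable_fst
  set L : ℕ → Fin p → ℝ := fun n j => lamn n j / √(n : ℝ) with hLdef
  have hL : Tendsto L atTop (𝓝 lam) := tendsto_pi_nhds.mpr hlam
  let γ := multivariateGaussian (0 : EuclideanSpace ℝ (Fin p)) (σ ^ 2 • C)
  let ν : (Fin p → ℝ) → ProbabilityMeasure (EuclideanSpace ℝ (Fin p)) := fun d =>
    ⟨multivariateGaussian (WithLp.toLp 2 (-(C⁻¹ *ᵥ (diagonal lam *ᵥ d)))) (σ ^ 2 • C⁻¹),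
      inferInstance⟩
  let V : ℕ → (Fin p → ℝ) → Ω → EuclideanSpace ℝ (Fin p) := fun n d ω =>
    WithLp.toLp 2 (orthantSolution (gramMatrix x n) (L n) d (score x n fun i => ε i ω))
  have hV : ∀ n d, AEMeasurable (V n d) P := fun n d =>
    aemeasurable_orthantSolution hε x n (gramMatrix x n) (L n) d
  let μ : (Fin p → ℝ) → ℕ → ProbabilityMeasure (EuclideanSpace ℝ (Fin p)) := fun d n =>
    ⟨P.map (V n d), Measure.isProbabilityMeasure_map (hV n d)⟩
  have hclt : ∀ d, Tendsto (μ d) atTop (𝓝 (ν d)) := fun d =>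
    ProbabilityMeasure.tendsto_iff_tendsto_charFun.mpr fun t =>
      tendsto_charFun_orthantSolution hσ hindep hident hmean hvar hC hX hL d t
  have hfront : ∀ d, (ν d : Measure _) (frontier M) = 0 := fun d =>
    multivariateGaussian_absolutelyContinuous _ (hC.inv.smul (sq_pos_of_pos hσ))
      (hM.volume_frontier hC.det_pos.ne'.isUnit)
  have hclosure : ∀ d, (ν d : Measure _) (closure M) = (ν d : Measure _) (interior M) := fun d =>
    le_antisymm (by
      rw [closure_eq_interior_union_frontier]
      refine (measure_union_le _ _).trans ?_
      rw [hfront d, add_zero]) (measure_mono (interior_subset.trans subset_closure))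
  -- `M` need not be Borel, so its preimage is squeezed between those of the interior and the
  -- closure, which carry equal mass.
  have hγ : ∀ d, γ {w | limitMinimizer C lam d w ∈ M} = (ν d : Measure _) (interior M) := fun d => by
    have hlaw := hasLaw_limitMinimizer hC σ lam d
    have hν : (ν d : Measure _) = γ.map (limitMinimizer C lam d) := hlaw.map_eq.symm
    refine le_antisymm ?_ ?_
    · rw [← hclosure d, hν, Measure.map_apply_of_aemeasurable hlaw.aemeasurable
        isClosed_closure.measurableSet]
      exact measure_mono fun w hw => subset_closure hw
    · rw [hν, Measure.map_apply_of_aemeasurable hlaw.aemeasurable isOpen_interior.measurableSet]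
      exact measure_mono fun w hw => interior_subset (s := M) hw
  have hcov0 : ∀ n, 0 ≤ ⨅ β : EuclideanSpace ℝ (Fin p), P.real {ω | β ∈ confidenceSet n M
      (lassoEstimator (designMatrix x n) (lamn n) (response x ε n β ω))} := fun n =>
    Real.iInf_nonneg fun β => measureReal_nonneg
  have hG := eventually_posDef_gramMatrix hC hX
  have hlower : ∀ c < 1 - α, ∀ᶠ n in atTop, c ≤ ⨅ β : EuclideanSpace ℝ (Fin p),
      P.real {ω | β ∈ confidenceSet n M
        (lassoEstimator (designMatrix x n) (lamn n) (response x ε n β ω))} := by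
    intro c hc
    rcases lt_or_ge c 0 with hc0 | hc0
    · exact .of_forall fun n => hc0.le.trans (hcov0 n)
    have key : ∀ d ∈ signVectors p, ∀ᶠ n in atTop, ∀ β : EuclideanSpace ℝ (Fin p),
        (∀ j, 0 ≤ d j * β j) → c ≤ P.real {ω | β ∈ confidenceSet n M
          (lassoEstimator (designMatrix x n) (lamn n) (response x ε n β ω))} := by
      intro d hd
      have h1 : ENNReal.ofReal c < (ν d : Measure _) (interior M) := by
        rw [← hγ d, ENNReal.ofReal_lt_iff_lt_toReal hc0 (measure_ne_top _ _)]
        exact hc.trans_le (hmin.2 ⟨d, hd, rfl⟩)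
      obtain ⟨δ, hδ, h2⟩ := exists_lt_measure_deepInterior h1
      have h3 := eventually_lt_of_lt_liminf (h2.trans_le
        (ProbabilityMeasure.le_liminf_measure_open_of_tendsto (hclt d) (isOpen_deepInterior M δ)))
      filter_upwards [h3, hG, eventually_gt_atTop 0, eventually_norm_correction_le hC hX hL hδ]
        with n hn1 hn2 hn3 hn4 β hβ
      have h4 : (μ d n : Measure _) (deepInterior M δ) = P (V n d ⁻¹' deepInterior M δ) :=
        Measure.map_apply_of_aemeasurable (hV n d) (isOpen_deepInterior M δ).measurableSet
      rw [h4] at hn1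
      have h5 := hn1.le.trans
        (measure_mono (deepInterior_subset_coverage (ε := ε) hC hM hn3 hn2 (hlamn n) hn4 hd β hβ))
      exact (ENNReal.ofReal_le_iff_le_toReal (measure_ne_top _ _)).mp h5
    -- Finitely many sign vectors cover all `β`, so a single threshold in `n` serves every
    -- parameter.
    filter_upwards [(Filter.eventually_all_finite (finite_signVectors p)).mpr key] with n hn
    refine le_ciInf fun β => ?_
    obtain ⟨d, hd, hdβ⟩ := exists_signVector_mul_nonneg β.ofLp
    exact hn d hd β hdβ
  have hupper : ∀ c > 1 - α, ∀ᶠ n in atTop, ⨅ β : EuclideanSpace ℝ (Fin p),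
      P.real {ω | β ∈ confidenceSet n M
        (lassoEstimator (designMatrix x n) (lamn n) (response x ε n β ω))} ≤ c := by
    intro c hc
    obtain ⟨d, hd, hdα⟩ := hmin.1
    have h1 : (ν d : Measure _) (closure M) < ENNReal.ofReal c := by
      rw [hclosure d, ← hγ d, ENNReal.lt_ofReal_iff_toReal_lt (measure_ne_top _ _)]
      exact hdα.trans_lt hc
    have h3 := eventually_lt_of_limsup_lt
      ((ProbabilityMeasure.limsup_measure_closed_le_of_tendsto (hclt d) isClosed_closure).trans_lt h1)
    filter_upwards [h3, hG, eventually_gt_atTop 0] with n hn1 hn2 hn3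
    refine (iInf_coverage_le hε hn3 hn2 (hlamn n) hd).trans ?_
    have h4 : (μ d n : Measure _) (closure M) = P (V n d ⁻¹' closure M) :=
      Measure.map_apply_of_aemeasurable (hV n d) isClosed_closure.measurableSet
    rw [h4] at hn1
    have h5 := (ENNReal.lt_ofReal_iff_toReal_lt (measure_ne_top _ _)).mp hn1
    exact (measureReal_mono (s₂ := V n d ⁻¹' closure M) fun ω hω =>
      subset_closure (s := M) hω).trans h5.le
  have htend : Tendsto (fun n : ℕ => ⨅ β : EuclideanSpace ℝ (Fin p),
      P.real {ω | β ∈ confidenceSet n M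
        (lassoEstimator (designMatrix x n) (lamn n) (response x ε n β ω))}) atTop
      (𝓝 (1 - α)) := by
    refine tendsto_order.mpr ⟨fun a ha => ?_, fun a ha => ?_⟩
    · obtain ⟨c, hac, hc⟩ := exists_between ha
      exact (hlower c hc).mono fun n hn => hac.trans_le hn
    · obtain ⟨c, hc, hca⟩ := exists_between ha
      exact (hupper c hc).mono fun n hn => hn.trans_lt hca
  exact htend.liminf_eq
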